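/- **Action theories.** Fix a set $\mathbf F$ of fluents and a set $\mathbf A$ of actions. A literal is $f$ or $\neg f$ with $f\in\mathbf F$; $\neg l$ denotes the complement of a literal $l$, and $\neg\sigma=\{\neg l\mid l\in\sigma\}$. A set of literals is *consistent* if it contains no two complementary literals. A *domain description* $\mathcal D$ is a set of propositions $\mathbf{executable}(a,\psi)$, $\mathbf{causes}(a,l,\phi)$, $\mathbf{if}(l,\varphi)$ and $\mathbf{determines}(a,\theta)$, where $a\in\mathbf A$, $l$ is a literal and $\psi,\phi,\varphi,\theta$ are sets of literals (read as conjunctions). $a$ is a *sensing action* if some $\mathbf{determines}(a,\theta)$ is in $\mathcal D$, and *non-sensing* otherwise. We assume: no sensing action occurs in a proposition $\mathbf{causes}(a,l,\phi)$; each sensing action occurs in just one proposition $\mathbf{determines}(a,\theta)$; each such $\theta$ has at least two elements and either is $\{f,\neg f\}$ for a fluent $f$, or $\mathcal D$ contains $\mathbf{if}(\neg g',\{g\})$ for all distinct $g,g'\in\theta$ and $\mathbf{if}(g,\{\neg g'\mid g'\in\theta\setminus\{g\}\})$ for all $g\in\theta$; and $\varphi\neq\emptyset$ for each $\mathbf{if}(l,\varphi)\in\mathcal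 D$. A *planning problem* is $\mathcal P=(\mathcal D,\mathcal I,\mathcal G)$, where $\mathcal I$ is a set of propositions $\mathbf{initially}(l)$ and $\mathcal G$ is a non-empty set of literals (read as a conjunction). $Cl_{\mathcal D}(\sigma)$ is the least set of literals that includes $\sigma$ and contains $l$ whenever $\mathbf{if}(l,\varphi)\in\mathcal D$ and it includes $\varphi$; sets with the latter property are *closed*. A *state* is a closed consistent set of literals that contains $f$ or $\neg f$ for each $f\in\mathbf F$; an *a-state* is a closed consistent set of literals, *valid* if it is included in a state. $a$ is *executable* in $\sigma$ if $\psi\subseteq\sigma$ for some $\mathbf{executable}(a,\psi)\in\mathcal D$. Put $E(a,\sigma)=\{l\mid \mathbf{causes}(a,l,\phi)\in\mathcal D,\ \phi\subseteq\sigma\}$. $\mathcal D$ is *consistent* if for every state $s$ and every non-sensing action $a$ executable in $s$ there is a state $s'$ with $s'=Cl_{\mathcal D}(E(a,s)\cup(s\cap s'))$. $(\mathcal D,\mathcal I)$ is *consistent* if $\mathcal D$ is consistent and the *initial a-state* $\delta_0=Cl_{\mathcal D}(\{l\mid\mathbf{initially}(l)\in\mathcal I\})$ is a valid a-state. **The 0-approximation.**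 For a non-sensing action $a$ put $e(a,\delta)=Cl_{\mathcal D}(E(a,\delta))$ and $pc(a,\delta)=\bigcup_i pc^i(a,\delta)$, where $pc^0(a,\delta)=\{l\mid \mathbf{causes}(a,l,\phi)\in\mathcal D,\ l\notin\delta,\ \neg\phi\cap\delta=\emptyset\}$ and $pc^{i+1}(a,\delta)=pc^i(a,\delta)\cup\{l\mid \mathbf{if}(l,\varphi)\in\mathcal D,\ l\notin\delta,\ \varphi\cap pc^i(a,\delta)\ne\emptyset,\ \neg\varphi\cap e(a,\delta)=\emptyset\}$. $Res(a,\delta)$ is the set whose only element is $\delta'=Cl_{\mathcal D}(e(a,\delta)\cup(\delta\setminus\neg pc(a,\delta)))$ if $\delta'$ is consistent, and $\emptyset$ otherwise. For a sensing action $a$ with $\mathbf{determines}(a,\theta)\in\mathcal D$, $Res(a,\delta)$ is the set of the consistent ones among the sets $Cl_{\mathcal D}(\delta\cup\{g\})$, $g\in\theta$. $\Phi(a,\delta)=Res(a,\delta)$ if $a$ is executable in $\delta$, and $\Phi(a,\delta)=\bot$ otherwise. *Conditional plans* are $[]$; $[a;p]$ with $a$ non-sensing and $p$ a conditional plan; and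 $[a;\mathbf{cases}(\{g\to p_g\}_{g\in\theta})]$ with $\mathbf{determines}(a,\theta)\in\mathcal D$ and conditional plans $p_g$. Put $\hat\Phi([],\delta)=\{\delta\}$; for the other two forms $\hat\Phi(p,\delta)=\bot$ if $\Phi(a,\delta)=\bot$, and otherwise $\hat\Phi([a;q],\delta)=\bigcup_{\delta'\in\Phi(a,\delta)}\hat\Phi(q,\delta')$ and $\hat\Phi([a;\mathbf{cases}(\{g\to p_g\}_{g\in\theta})],\delta)=\bigcup\{\hat\Phi(p_g,\delta')\mid g\in\theta,\ \delta'\in\Phi(a,\delta),\ g\in\delta'\}$, where a union with a member $\bot$ is $\bot$. A conditional plan $p$ is a *solution* to $\mathcal P$ if $\hat\Phi(p,\delta_0)\ne\bot$ and $\mathcal G\subseteq\delta$ for every $\delta\in\hat\Phi(p,\delta_0)$. **The program.** For $h,w\ge1$, $\pi_{h,w}(\mathcal P)$ consists of the ground instances of the rules below, with $T\in\{1,\dots,h\}$, $T_1\in\{1,\dots,h+1\}$, $P,P_1,P_2\in\{1,\dots,w\}$, $F$ a fluent, $L,L_1$ literals, $A$ an action, and $G,G_1,G_2$ sensed literals (members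 of some $\theta$ with $\mathbf{determines}(a,\theta)\in\mathcal D$); comparisons are conditions on the instances. For a set $\gamma$, $p(\gamma,\dots)$ in a body stands for all $p(x,\dots)$, $x\in\gamma$, and $\mathit{not}\ p(\gamma,\dots)$ for all $\mathit{not}\ p(x,\dots)$, $x\in\gamma$. - Facts: $time(T)$; $time1(T_1)$; $path(P)$; $action(A)$; $fluent(F)$; $sense(G)$; $literal(F)$; $literal(\neg F)$; $contrary(F,\neg F)$; $contrary(\neg F,F)$; $new\_br(P,P_1)$ if $P\le P_1$; $used(1,1)$; $holds(l,1,1)$ for $\mathbf{initially}(l)\in\mathcal I$. - For $\mathbf{executable}(a,\psi)\in\mathcal D$: $poss(a,T,P)\leftarrow holds(\psi,T,P)$. - For $\mathbf{causes}(a,l,\phi)\in\mathcal D$: $e(l,T,P)\leftarrow occ(a,T,P),holds(\phi,T,P)$; $\ pc(l,T,P)\leftarrow occ(a,T,P),\mathit{not}\ holds(l,T,P),\mathit{not}\ holds(\neg\phi,T,P)$. - For $\mathbf{determines}(a,\theta)\in\mathcal D$: $\leftarrow occ(a,T,P),\mathit{not}\ br(\theta,T,P,P)$; and for each $g\in\theta$: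 $\ 1\{br(g,T,P,X)\mid P\le X\le w\}1\leftarrow occ(a,T,P)$; $\ \leftarrow occ(a,T,P),holds(g,T,P)$. - For $\mathbf{if}(l,\varphi)\in\mathcal D$: $pc(l,T,P)\leftarrow \mathit{not}\ holds(l,T,P),pc(l',T,P),\mathit{not}\ e(\neg\varphi,T,P)$ for each $l'\in\varphi$; $\ e(l,T,P)\leftarrow e(\varphi,T,P)$; $\ holds(l,T_1,P)\leftarrow holds(\varphi,T_1,P)$. - $goal(T_1,P)\leftarrow holds(\mathcal G,T_1,P)$; $\ goal(T_1,P)\leftarrow holds(L,T_1,P),holds(L_1,T_1,P),contrary(L,L_1)$; $\ \leftarrow used(h{+}1,P),\mathit{not}\ goal(h{+}1,P)$. - $holds(L,T{+}1,P)\leftarrow e(L,T,P)$; $\ holds(L,T{+}1,P)\leftarrow holds(L,T,P),contrary(L,L_1),\mathit{not}\ pc(L_1,T,P)$. - $\leftarrow br(G_1,T,P_1,P),br(G_2,T,P_2,P)$ if $P_1<P_2<P$; $\ \leftarrow br(G_1,T,P_1,P),br(G_2,T,P_1,P)$ if $P_1\le P$, $G_1\ne G_2$; $\ \leftarrow br(G,T,P_1,P),used(T,P)$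 if $P_1<P$. - $used(T{+}1,P)\leftarrow br(G,T,P_1,P)$ if $P_1<P$; $\ holds(G,T{+}1,P)\leftarrow br(G,T,P_1,P)$ if $P_1\le P$; $\ holds(L,T{+}1,P)\leftarrow br(G,T,P_1,P),holds(L,T,P_1)$ if $P_1<P$. - $1\{occ(a,T,P)\mid a\in\mathbf A\}1\leftarrow used(T,P),\mathit{not}\ goal(T,P)$; $\ \leftarrow occ(A,T,P),\mathit{not}\ poss(A,T,P)$; $\ used(T{+}1,P)\leftarrow used(T,P)$. A set $S$ of atoms is an *answer set* of the program if $S$ satisfies all its rules (a head $1\{B\}1$ is satisfied if $|B\cap S|=1$, an empty head never) and $S$ is the least set of atoms closed under the reduct with respect to $S$, that is, under the rules $x\leftarrow body^+$ obtained from the rules whose body has no $\mathit{not}\ y$ with $y\in S$, where $body^+$ is the set of positive body atoms and $x$ is the head atom, or any member of $B\cap S$ if the head is $1\{B\}1$. **Extraction.** For an answer set $S$, $1\le i\le h+1$ and $1\le k\le w$, the plan $p_i^k(S)$ is $[]$ if $i=h+1$ or $occ(a,i,k)\notin S$ for all $a$; it is $[a;p_{i+1}^k(S)]$ if $i\le h$,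 $occ(a,i,k)\in S$ and $a$ is non-sensing; and it is $[a;\mathbf{cases}(\{g\to p_{i+1}^{k_g}(S)\}_{g\in\theta})]$ if $i\le h$, $occ(a,i,k)\in S$, $\mathbf{determines}(a,\theta)\in\mathcal D$ and $br(g,i,k,k_g)\in S$ for all $g\in\theta$. **Theorem 3.1.** Let $(\mathcal D,\mathcal I)$ be a consistent action theory, $\mathcal P=(\mathcal D,\mathcal I,\mathcal G)$ a planning problem, and $h,w\ge1$ integers. If $S$ is an answer set of $\pi_{h,w}(\mathcal P)$, then the extraction returns exactly one plan $p_1^1(S)$, and $p_1^1(S)$ is a conditional plan that is a solution to $\mathcal P$. -/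

import Mathlib

namespace ASCP

/-! ### Action theories -/

/-- A fluent literal over the fluents `F`: a fluent `f` or its negation. -/
inductive Lit (F : Type*) where
  | pos (f : F) : Lit F
  | neg (f : F) : Lit F

/-- The complement of a literal. -/
def Lit.compl {F : Type*} : Lit F → Lit F
  | .pos f => .neg f
  | .neg f => .pos f

/-- The propositions a domain description consists of. A set of literals in a proposition is read as
the conjunction of its members. -/
inductive Proposition (F A : Type*) where
  /-- `a` is executable in any situation in which `ψ` holds -/
  | executable (a : A) (ψ : Set (Lit F)) : Proposition F A
  /-- dynamic causal law: performing `a` where `φ` holds causes `l` -/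
  | causes (a : A) (l : Lit F) (φ : Set (Lit F)) : Proposition F A
  /-- static causal law `if(l, φ)`: `l` holds in any situation in which `φ` holds -/
  | staticLaw (l : Lit F) (φ : Set (Lit F)) : Proposition F A
  /-- knowledge proposition: the values of the literals in `θ` are known after `a` -/
  | determines (a : A) (θ : Set (Lit F)) : Proposition F A

/-- A domain description is a set of propositions. -/
abbrev Domain (F A : Type*) := Set (Proposition F A)

section Semantics

variable {F A : Type*}

/-- A sensing action is one that occurs in a knowledge proposition; the others are non-sensing. -/
def Sensing (D : Domain F A) (a : A) : Prop :=
  ∃ θ, Proposition.determines a θ ∈ D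

/-- `D` contains `oneof(θ)`: the literals of `θ` are mutually exclusive, and each one follows from
the negations of all the others. -/
def ContainsOneof (D : Domain F A) (θ : Set (Lit F)) : Prop :=
  (∀ g ∈ θ, ∀ g' ∈ θ, g ≠ g' → Proposition.staticLaw g'.compl {g} ∈ D) ∧
  (∀ g ∈ θ, Proposition.staticLaw g (Lit.compl '' (θ \ {g})) ∈ D)

/-- The syntactic conventions on domain descriptions. -/
structure WellFormed (D : Domain F A) : Prop where
  /-- sensing actions do not occur in dynamic causal laws -/
  disjoint : ∀ a l φ, Proposition.causes a l φ ∈ D → ¬ Sensing D a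
  /-- each sensing action occurs in just one knowledge proposition -/
  determines_unique : ∀ a θ θ', Proposition.determines a θ ∈ D →
    Proposition.determines a θ' ∈ D → θ = θ'
  /-- at least two literals are sensed -/
  determines_nontrivial : ∀ a θ, Proposition.determines a θ ∈ D → θ.Nontrivial
  /-- the sensed literals are a complementary pair, or `oneof` of them is in `D` -/
  determines_oneof : ∀ a θ, Proposition.determines a θ ∈ D →
    (∃ f, θ = {Lit.pos f, Lit.neg f}) ∨ ContainsOneof D θ
  /-- no static causal law has an empty body -/
  static_nonempty : ∀ l φ, Proposition.staticLaw l φ ∈ D → φ.Nonempty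

/-- A set of literals is consistent if it does not contain two complementary literals. -/
def Consistent (σ : Set (Lit F)) : Prop :=
  ∀ l ∈ σ, l.compl ∉ σ

/-- `γ` possibly holds in `σ`: no complement of a member of `γ` is in `σ`.
(`γ` holds in `σ` is just `γ ⊆ σ`.) -/
def PossiblyHolds (γ σ : Set (Lit F)) : Prop :=
  (Lit.compl '' γ) ∩ σ = ∅

/-- `σ` satisfies all static causal laws of `D`. -/
def SatisfiesStatic (D : Domain F A) (σ : Set (Lit F)) : Prop :=
  ∀ l φ, Proposition.staticLaw l φ ∈ D → φ ⊆ σ → l ∈ σ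

/-- The smallest set of literals that includes `σ` and satisfies all static causal laws. -/
def Cl (D : Domain F A) (σ : Set (Lit F)) : Set (Lit F) :=
  ⋂₀ {τ | σ ⊆ τ ∧ SatisfiesStatic D τ}

/-- A state: a complete and consistent set of literals satisfying all static causal laws. -/
structure IsState (D : Domain F A) (s : Set (Lit F)) : Prop where
  complete : ∀ f, Lit.pos f ∈ s ∨ Lit.neg f ∈ s
  consistent : Consistent s
  satisfies : SatisfiesStatic D s

/-- An action is executable in `σ` if the body of one of its executability conditions holds. -/
def Executable (D : Domain F A) (a : A) (σ : Set (Lit F)) : Prop :=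
  ∃ ψ, Proposition.executable a ψ ∈ D ∧ ψ ⊆ σ

/-- Direct effects of `a` in `σ`. -/
def directEffects (D : Domain F A) (a : A) (σ : Set (Lit F)) : Set (Lit F) :=
  {l | ∃ φ, Proposition.causes a l φ ∈ D ∧ φ ⊆ σ}

/-- Possible next states after a non-sensing action, under complete information. -/
def ResC (D : Domain F A) (a : A) (s : Set (Lit F)) : Set (Set (Lit F)) :=
  {s' | IsState D s' ∧ s' = Cl D (directEffects D a s ∪ (s ∩ s'))}

/-- A domain description is consistent if every non-sensing action that is executable in a state
has a possible next state. -/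
def ConsistentDomain (D : Domain F A) : Prop :=
  ∀ s, IsState D s → ∀ a, ¬ Sensing D a → Executable D a s → (ResC D a s).Nonempty

/-- An a-state is a consistent set of literals satisfying all static causal laws. -/
def IsAState (D : Domain F A) (δ : Set (Lit F)) : Prop :=
  Consistent δ ∧ SatisfiesStatic D δ

/-- An a-state is valid if it is a subset of some state. -/
def IsValid (D : Domain F A) (δ : Set (Lit F)) : Prop :=
  IsAState D δ ∧ ∃ s, IsState D s ∧ δ ⊆ s

/-- The initial a-state, where `I` is the set of the literals `l` with `initially(l)`. -/
def initialAState (D : Domain F A) (I : Set (Lit F)) : Set (Lit F) :=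
  Cl D I

/-- Consistent action theories. -/
def ConsistentTheory (D : Domain F A) (I : Set (Lit F)) : Prop :=
  ConsistentDomain D ∧ IsValid D (initialAState D I)

/-! ### The 0-approximation -/

/-- What definitely holds after the non-sensing action `a`. -/
def eff (D : Domain F A) (a : A) (δ : Set (Lit F)) : Set (Lit F) :=
  Cl D (directEffects D a δ)

/-- The stages of the set of literals that may change. -/
def pcStage (D : Domain F A) (a : A) (δ : Set (Lit F)) : ℕ → Set (Lit F)
  | 0 => {l | ∃ φ, Proposition.causes a l φ ∈ D ∧ l ∉ δ ∧ PossiblyHolds φ δ}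
  | i + 1 => pcStage D a δ i ∪
      {l | ∃ φ, Proposition.staticLaw l φ ∈ D ∧ l ∉ δ ∧ (φ ∩ pcStage D a δ i).Nonempty ∧
        PossiblyHolds φ (eff D a δ)}

/-- What may change when the non-sensing action `a` is performed. -/
def possibleChanges (D : Domain F A) (a : A) (δ : Set (Lit F)) : Set (Lit F) :=
  ⋃ i, pcStage D a δ i

/-- The result function for non-sensing actions: a single a-state, or none. -/
def ResNonSensing (D : Domain F A) (a : A) (δ : Set (Lit F)) : Set (Set (Lit F)) :=
  {δ' | δ' = Cl D (eff D a δ ∪ (δ \ (Lit.compl '' possibleChanges D a δ))) ∧ Consistent δ'}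

/-- The result function for sensing actions: one a-state for each sensed literal that is
consistent with what is known. -/
def ResSensing (D : Domain F A) (a : A) (δ : Set (Lit F)) : Set (Set (Lit F)) :=
  {δ' | ∃ θ, Proposition.determines a θ ∈ D ∧ ∃ g ∈ θ, δ' = Cl D (δ ∪ {g}) ∧ Consistent δ'}

open Classical in
/-- The transition function; `none` stands for `⊥` (the action is not executable). -/
noncomputable def Phi (D : Domain F A) (a : A) (δ : Set (Lit F)) : Option (Set (Set (Lit F))) :=
  if Executable D a δ then
    some (if Sensing D a then ResSensing D a δ else ResNonSensing D a δ)
  else none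

/-- Raw conditional plans: the empty plan, an action followed by a plan, an action followed by a case
distinction with one subplan for each literal in `θ`. -/
inductive Plan (F A : Type*) where
  | empty : Plan F A
  | seq (a : A) (p : Plan F A) : Plan F A
  | cases (a : A) (θ : Set (Lit F)) (p : θ → Plan F A) : Plan F A

/-- The conditional plans of `D`: the actions of `seq` are non-sensing, those of `cases` are sensing
actions and the cases are the literals they sense. -/
def IsConditionalPlan (D : Domain F A) : Plan F A → Prop
  | .empty => True
  | .seq a p => ¬ Sensing D a ∧ IsConditionalPlan D p
  | .cases a θ p => Proposition.determines a θ ∈ D ∧ ∀ g, IsConditionalPlan D (p g)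

open Classical in
/-- The union of the sets `f i`, `i ∈ s`, with the convention that it is `⊥` if one of them is. -/
noncomputable def unionBot {ι β : Type*} (s : Set ι) (f : ι → Option (Set β)) : Option (Set β) :=
  if ∃ i ∈ s, f i = none then none else some {x | ∃ i ∈ s, ∃ Y, f i = some Y ∧ x ∈ Y}

/-- The extended transition function. -/
noncomputable def PhiHat (D : Domain F A) : Plan F A → Set (Lit F) → Option (Set (Set (Lit F)))
  | .empty, δ => some {δ}
  | .seq a q, δ =>
      match Phi D a δ with
      | none => none
      | some X => unionBot X (fun δ' => PhiHat D q δ')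
  | .cases a θ p, δ =>
      match Phi D a δ with
      | none => none
      | some X => unionBot {x : θ × Set (Lit F) | x.2 ∈ X ∧ (x.1 : Lit F) ∈ x.2}
          (fun x => PhiHat D (p x.1) x.2)

/-- `D` entails, from `I`, that the conjunction of the literals in `G` is known after `p`. -/
def EntailsKnowsAfter (D : Domain F A) (I G : Set (Lit F)) (p : Plan F A) : Prop :=
  ∃ X, PhiHat D p (initialAState D I) = some X ∧ ∀ δ ∈ X, G ⊆ δ

/-- `p` is a conditional plan that achieves the goal `G`. -/
def IsSolution (D : Domain F A) (I G : Set (Lit F)) (p : Plan F A) : Prop :=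
  IsConditionalPlan D p ∧ EntailsKnowsAfter D I G p

end Semantics

/-! ### Logic programs with cardinality heads, and their answer sets -/

/-- Heads of ground rules: an atom, the empty head of a constraint, or a cardinality
head `l {s} u`. -/
inductive Head (α : Type*) where
  | atom (x : α) : Head α
  | falsum : Head α
  | card (l : ℕ) (s : Set α) (u : ℕ) : Head α

/-- A ground rule: its head, the atoms `x` of its body, and the atoms `x` with `not x` in its
body. -/
structure Rule (α : Type*) where
  head : Head α
  pos : Set α
  neg : Set α

section AnswerSets

variable {α : Type*}

/-- Satisfaction of a head by a set of atoms. -/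
def Head.Holds (S : Set α) : Head α → Prop
  | .atom x => x ∈ S
  | .falsum => False
  | .card l s u => (l : ℕ∞) ≤ (s ∩ S).encard ∧ (s ∩ S).encard ≤ (u : ℕ∞)

/-- Satisfaction of a rule by a set of atoms. -/
def Rule.Holds (S : Set α) (r : Rule α) : Prop :=
  r.pos ⊆ S → Disjoint r.neg S → r.head.Holds S

/-- The atoms that head a rule in the reduct with respect to `S`: from a cardinality head, those of
its atoms that are in `S`. -/
def Head.reduct (S : Set α) : Head α → Set α
  | .atom x => {x}
  | .falsum => ∅
  | .card _ s _ => s ∩ S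

/-- `X` is closed under the reduct of `Q` with respect to `S`, which consists of the
rules `x ← r.pos`, for the rules `r` of `Q` with no `not y`, `y ∈ S`, in the body
and `x ∈ r.head.reduct S`. -/
def ClosedUnderReduct (Q : Set (Rule α)) (S X : Set α) : Prop :=
  ∀ r ∈ Q, Disjoint r.neg S → r.pos ⊆ X → r.head.reduct S ⊆ X

/-- Answer sets (stable models): `S` satisfies all rules and is the least set of atoms that is closed
under the reduct with respect to `S`. -/
def IsAnswerSet (Q : Set (Rule α)) (S : Set α) : Prop :=
  (∀ r ∈ Q, r.Holds S) ∧ IsLeast {X | ClosedUnderReduct Q S X} S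

/-- `x ←` -/
def fact (x : α) : Rule α := ⟨.atom x, ∅, ∅⟩

/-- `x ← pos, not neg` -/
def normal (x : α) (pos neg : Set α) : Rule α := ⟨.atom x, pos, neg⟩

/-- `← pos, not neg` -/
def constraint (pos neg : Set α) : Rule α := ⟨.falsum, pos, neg⟩

/-- `1 {s} 1 ← pos, not neg` -/
def exactlyOne (s : Set α) (pos neg : Set α) : Rule α := ⟨.card 1 s 1, pos, neg⟩

end AnswerSets

/-! ### The encoding -/

/-- The ground atoms of the encoding. -/
inductive Atom (F A : Type*) where
  | time (t : ℕ) : Atom F A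
  | time1 (t : ℕ) : Atom F A
  | path (p : ℕ) : Atom F A
  | action (a : A) : Atom F A
  | fluent (f : F) : Atom F A
  | sense (g : Lit F) : Atom F A
  | literal (l : Lit F) : Atom F A
  | contrary (l l₁ : Lit F) : Atom F A
  | holds (l : Lit F) (t p : ℕ) : Atom F A
  | poss (a : A) (t p : ℕ) : Atom F A
  | occ (a : A) (t p : ℕ) : Atom F A
  | e (l : Lit F) (t p : ℕ) : Atom F A
  | pc (l : Lit F) (t p : ℕ) : Atom F A
  | goal (t p : ℕ) : Atom F A
  | br (g : Lit F) (t p p₁ : ℕ) : Atom F A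
  | used (t p : ℕ) : Atom F A
  | newBr (p p₁ : ℕ) : Atom F A

section Encoding

variable {F A : Type*}

/-- `g` is a sensed literal of `D`. -/
def SensedLit (D : Domain F A) (g : Lit F) : Prop :=
  ∃ a θ, Proposition.determines a θ ∈ D ∧ g ∈ θ

open Atom Proposition Set in
/-- The ground rules of the encoding of the problem `(D, I, G)` with `h` rows and `w` columns. Every
variable ranges over its sort: `t ∈ Icc 1 h` for times, `t ∈ Icc 1 (h + 1)` for extended times,
`p, p₁, p₂ ∈ Icc 1 w` for paths, sensed literals for `g, g₁, g₂`. Arithmetic comparisons and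
the conditions in cardinality heads are evaluated in the ground instances. -/
inductive EncodingRule (D : Domain F A) (I G : Set (Lit F)) (h w : ℕ) :
    Rule (Atom F A) → Prop
  -- facts for the sorts
  | time (t : ℕ) : t ∈ Icc 1 h → EncodingRule D I G h w (fact (time t))
  | time1 (t : ℕ) : t ∈ Icc 1 (h + 1) → EncodingRule D I G h w (fact (time1 t))
  | path (p : ℕ) : p ∈ Icc 1 w → EncodingRule D I G h w (fact (path p))
  | action (a : A) : EncodingRule D I G h w (fact (action a))
  | fluent (f : F) : EncodingRule D I G h w (fact (fluent f))
  | sense (g : Lit F) : SensedLit D g → EncodingRule D I G h w (fact (sense g))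
  -- initial situation
  | init (l : Lit F) : l ∈ I → EncodingRule D I G h w (fact (holds l 1 1))
  -- executability conditions
  | poss (a : A) (ψ : Set (Lit F)) (t p : ℕ) : executable a ψ ∈ D → t ∈ Icc 1 h → p ∈ Icc 1 w →
      EncodingRule D I G h w (normal (poss a t p) {x | ∃ l ∈ ψ, x = holds l t p} ∅)
  -- effects of non-sensing actions
  | causes_e (a : A) (l : Lit F) (φ : Set (Lit F)) (t p : ℕ) :
      causes a l φ ∈ D → t ∈ Icc 1 h → p ∈ Icc 1 w →
      EncodingRule D I G h w
        (normal (e l t p) ({occ a t p} ∪ {x | ∃ m ∈ φ, x = holds m t p}) ∅)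
  | causes_pc (a : A) (l : Lit F) (φ : Set (Lit F)) (t p : ℕ) :
      causes a l φ ∈ D → t ∈ Icc 1 h → p ∈ Icc 1 w →
      EncodingRule D I G h w
        (normal (pc l t p) {occ a t p} ({holds l t p} ∪ {x | ∃ m ∈ φ, x = holds m.compl t p}))
  -- effects of sensing actions
  | sense_stay (a : A) (θ : Set (Lit F)) (t p : ℕ) :
      determines a θ ∈ D → t ∈ Icc 1 h → p ∈ Icc 1 w →
      EncodingRule D I G h w (constraint {occ a t p} {x | ∃ g ∈ θ, x = br g t p p})
  | sense_branch (a : A) (θ : Set (Lit F)) (g : Lit F) (t p : ℕ) :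
      determines a θ ∈ D → g ∈ θ → t ∈ Icc 1 h → p ∈ Icc 1 w →
      EncodingRule D I G h w
        (exactlyOne {x | ∃ p₁ ∈ Icc 1 w, p ≤ p₁ ∧ x = br g t p p₁} {occ a t p} ∅)
  | sense_unknown (a : A) (θ : Set (Lit F)) (g : Lit F) (t p : ℕ) :
      determines a θ ∈ D → g ∈ θ → t ∈ Icc 1 h → p ∈ Icc 1 w →
      EncodingRule D I G h w (constraint {occ a t p, holds g t p} ∅)
  -- static causal laws
  | static_pc (l : Lit F) (φ : Set (Lit F)) (l' : Lit F) (t p : ℕ) :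
      staticLaw l φ ∈ D → l' ∈ φ → t ∈ Icc 1 h → p ∈ Icc 1 w →
      EncodingRule D I G h w
        (normal (pc l t p) {pc l' t p} ({holds l t p} ∪ {x | ∃ m ∈ φ, x = e m.compl t p}))
  | static_e (l : Lit F) (φ : Set (Lit F)) (t p : ℕ) :
      staticLaw l φ ∈ D → t ∈ Icc 1 h → p ∈ Icc 1 w →
      EncodingRule D I G h w (normal (e l t p) {x | ∃ m ∈ φ, x = e m t p} ∅)
  | static_holds (l : Lit F) (φ : Set (Lit F)) (t p : ℕ) :
      staticLaw l φ ∈ D → t ∈ Icc 1 (h + 1) → p ∈ Icc 1 w →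
      EncodingRule D I G h w (normal (holds l t p) {x | ∃ m ∈ φ, x = holds m t p} ∅)
  -- goal
  | goal_reached (t p : ℕ) : t ∈ Icc 1 (h + 1) → p ∈ Icc 1 w →
      EncodingRule D I G h w (normal (goal t p) {x | ∃ l ∈ G, x = holds l t p} ∅)
  | goal_inconsistent (l l₁ : Lit F) (t p : ℕ) : t ∈ Icc 1 (h + 1) → p ∈ Icc 1 w →
      EncodingRule D I G h w
        (normal (goal t p) {holds l t p, holds l₁ t p, contrary l l₁} ∅)
  | goal_check (p : ℕ) : p ∈ Icc 1 w →
      EncodingRule D I G h w (constraint {used (h + 1) p} {goal (h + 1) p})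
  -- effect and frame axioms for non-sensing actions
  | effect (l : Lit F) (t p : ℕ) : t ∈ Icc 1 h → p ∈ Icc 1 w →
      EncodingRule D I G h w (normal (holds l (t + 1) p) {e l t p} ∅)
  | inertia (l l₁ : Lit F) (t p : ℕ) : t ∈ Icc 1 h → p ∈ Icc 1 w →
      EncodingRule D I G h w
        (normal (holds l (t + 1) p) {holds l t p, contrary l l₁} {pc l₁ t p})
  -- branching at sensing actions
  | br_source (g₁ g₂ : Lit F) (t p p₁ p₂ : ℕ) : SensedLit D g₁ → SensedLit D g₂ →
      t ∈ Icc 1 h → p ∈ Icc 1 w → p₁ ∈ Icc 1 w → p₂ ∈ Icc 1 w → p₁ < p₂ → p₂ < p →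
      EncodingRule D I G h w (constraint {br g₁ t p₁ p, br g₂ t p₂ p} ∅)
  | br_label (g₁ g₂ : Lit F) (t p p₁ : ℕ) : SensedLit D g₁ → SensedLit D g₂ →
      t ∈ Icc 1 h → p ∈ Icc 1 w → p₁ ∈ Icc 1 w → p₁ ≤ p → g₁ ≠ g₂ →
      EncodingRule D I G h w (constraint {br g₁ t p₁ p, br g₂ t p₁ p} ∅)
  | br_fresh (g : Lit F) (t p p₁ : ℕ) : SensedLit D g →
      t ∈ Icc 1 h → p ∈ Icc 1 w → p₁ ∈ Icc 1 w → p₁ < p →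
      EncodingRule D I G h w (constraint {br g t p₁ p, used t p} ∅)
  | br_used (g : Lit F) (t p p₁ : ℕ) : SensedLit D g →
      t ∈ Icc 1 h → p ∈ Icc 1 w → p₁ ∈ Icc 1 w → p₁ < p →
      EncodingRule D I G h w (normal (used (t + 1) p) {br g t p₁ p} ∅)
  | br_holds (g : Lit F) (t p p₁ : ℕ) : SensedLit D g →
      t ∈ Icc 1 h → p ∈ Icc 1 w → p₁ ∈ Icc 1 w → p₁ ≤ p →
      EncodingRule D I G h w (normal (holds g (t + 1) p) {br g t p₁ p} ∅)
  | br_copy (g l : Lit F) (t p p₁ : ℕ) : SensedLit D g →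
      t ∈ Icc 1 h → p ∈ Icc 1 w → p₁ ∈ Icc 1 w → p₁ < p →
      EncodingRule D I G h w
        (normal (holds l (t + 1) p) {br g t p₁ p, holds l t p₁} ∅)
  -- generation of action occurrences
  | occ_generate (t p : ℕ) : t ∈ Icc 1 h → p ∈ Icc 1 w →
      EncodingRule D I G h w
        (exactlyOne {x | ∃ a, x = occ a t p} {used t p} {goal t p})
  | occ_poss (a : A) (t p : ℕ) : t ∈ Icc 1 h → p ∈ Icc 1 w →
      EncodingRule D I G h w (constraint {occ a t p} {poss a t p})
  -- auxiliary rules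
  | literal_pos (f : F) : EncodingRule D I G h w (fact (literal (.pos f)))
  | literal_neg (f : F) : EncodingRule D I G h w (fact (literal (.neg f)))
  | contrary_pos (f : F) : EncodingRule D I G h w (fact (contrary (.pos f) (.neg f)))
  | contrary_neg (f : F) : EncodingRule D I G h w (fact (contrary (.neg f) (.pos f)))
  | new_branch (p p₁ : ℕ) : p ∈ Icc 1 w → p₁ ∈ Icc 1 w → p ≤ p₁ →
      EncodingRule D I G h w (fact (newBr p p₁))
  | used_root : EncodingRule D I G h w (fact (used 1 1))
  | used_next (t p : ℕ) : t ∈ Icc 1 h → p ∈ Icc 1 w →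
      EncodingRule D I G h w (normal (used (t + 1) p) {used t p} ∅)

/-- The logic program that encodes the planning problem `(D, I, G)` on the `h × w` grid. -/
def encoding (h w : ℕ) (D : Domain F A) (I G : Set (Lit F)) : Set (Rule (Atom F A)) :=
  {r | EncodingRule D I G h w r}

/-- `ExtractedPlan D h S i k p`: the extraction procedure returns the plan `p` from the set of
atoms `S`, started at row `i` and column `k`. -/
inductive ExtractedPlan (D : Domain F A) (h : ℕ) (S : Set (Atom F A)) :
    ℕ → ℕ → Plan F A → Prop
  | finished (i k : ℕ) : (i = h + 1 ∨ ∀ a, Atom.occ a i k ∉ S) →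
      ExtractedPlan D h S i k Plan.empty
  | nonSensing (i k : ℕ) (a : A) (p : Plan F A) : i ≤ h → Atom.occ a i k ∈ S → ¬ Sensing D a →
      ExtractedPlan D h S (i + 1) k p → ExtractedPlan D h S i k (Plan.seq a p)
  | sensing (i k : ℕ) (a : A) (θ : Set (Lit F)) (c : θ → ℕ) (p : θ → Plan F A) :
      i ≤ h → Atom.occ a i k ∈ S → Proposition.determines a θ ∈ D →
      (∀ g : θ, Atom.br (g : Lit F) i k (c g) ∈ S) →
      (∀ g : θ, ExtractedPlan D h S (i + 1) (c g) (p g)) →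
      ExtractedPlan D h S i k (Plan.cases a θ p)

end Encoding

end ASCP

namespace ASCP

/-! An answer set describes a grid whose cell `(t, p)` carries the set `stateAt S t p` of literals
that hold there. The point is that these sets follow the 0-approximation exactly along the extracted
plan. A non-sensing action keeps its column and turns the set into the candidate successor of
`ResNonSensing` (`stateAt_succ_of_nonSensing`); a branch labelled `g` leads to a cell that carries
the closure of the old set with `g` (`stateAt_succ_of_br_mem`).

Both rest on the minimality of an answer set: an atom has a derivation, so a cell contains only what
some rule puts there (`stateAt_subset`), and the constraints on branches and used cells leave just
one source for each cell. By the same minimality the `e` and `pc` atoms are exactly the effects and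
the possible changes (`e_mem_iff`, `pc_mem_iff`).

Choice rules fix one action per cell and one target per sensed literal, so the extraction is
deterministic. Where it stops, the cell satisfies `goal`, which means that the goal holds or that
the cell is inconsistent. The second alternative is harmless: the transition function discards
inconsistent results, so only consistent cells have to be followed (`ExtractedPlan.phiHat`). -/

theorem Lit.compl_compl {F : Type*} (l : Lit F) : l.compl.compl = l := by
  cases l <;> rfl

theorem Lit.mem_image_compl {F : Type*} {l : Lit F} {σ : Set (Lit F)} :
    l ∈ Lit.compl '' σ ↔ l.compl ∈ σ := by
  constructor
  · rintro ⟨m, hm, rfl⟩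
    rwa [Lit.compl_compl]
  · exact fun hl => ⟨l.compl, hl, l.compl_compl⟩

/-! ### Closure under static causal laws -/

section Closure

variable {F A : Type*} {D : Domain F A} {σ τ : Set (Lit F)}

theorem subset_Cl : σ ⊆ Cl D σ := fun _ hl _ hτ => hτ.1 hl

theorem satisfiesStatic_Cl : SatisfiesStatic D (Cl D σ) := fun l φ hlφ hφ τ hτ =>
  hτ.2 l φ hlφ fun _ hm => hφ hm τ hτ

theorem Cl_subset (hσ : σ ⊆ τ) (hτ : SatisfiesStatic D τ) : Cl D σ ⊆ τ := fun _ hl => hl τ ⟨hσ, hτ⟩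

theorem Cl_empty (hD : WellFormed D) : Cl D (∅ : Set (Lit F)) = ∅ := by
  refine Set.subset_empty_iff.1 (Cl_subset subset_rfl fun l φ hlφ hφ => ?_)
  obtain ⟨m, hm⟩ := hD.static_nonempty l φ hlφ
  exact (hφ hm).elim

/-- The sensed literals of one sensing action exclude each other. -/
theorem WellFormed.eq_of_mem_of_mem (hD : WellFormed D) {a : A} {θ : Set (Lit F)}
    (hθ : Proposition.determines a θ ∈ D) (hs : SatisfiesStatic D σ) (hc : Consistent σ)
    {g g' : Lit F} (hg : g ∈ θ) (hg' : g' ∈ θ) (hgσ : g ∈ σ) (hgσ' : g' ∈ σ) : g = g' := by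
  by_contra hne
  rcases hD.determines_oneof a θ hθ with ⟨f, rfl⟩ | hone
  · rcases hg with rfl | rfl <;> rcases hg' with rfl | rfl
    · exact hne rfl
    · exact hc _ hgσ hgσ'
    · exact hc _ hgσ hgσ'
    · exact hne rfl
  · exact hc _ hgσ' (hs _ _ (hone.1 g hg g' hg' hne) (by simpa using hgσ))

end Closure

/-! ### Derivations in answer sets -/

section AnswerSets

variable {α : Type*} {Q : Set (Rule α)} {S : Set α}

/-- Minimality: the atoms of `S` with property `P` are closed under the reduct, hence exhaust `S`.
Intersecting with `S` is what makes `r.pos ⊆ S` available in the induction step. -/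
theorem IsAnswerSet.induction (hS : IsAnswerSet Q S) {P : α → Prop}
    (H : ∀ r ∈ Q, Disjoint r.neg S → r.pos ⊆ S → (∀ y ∈ r.pos, P y) →
      ∀ x ∈ r.head.reduct S, P x) {x : α} (hx : x ∈ S) : P x := by
  have hle : S ≤ {x | x ∈ S ∧ P x} := hS.2.2 fun r hr hneg hpos x hxr =>
    ⟨hS.2.1 r hr hneg (fun y hy => (hpos hy).1) hxr,
      H r hr hneg (fun y hy => (hpos hy).1) (fun y hy => (hpos hy).2) x hxr⟩
  exact (hle hx).2

/-- Supportedness. It serves for inversion: only few rules can have a given kind of atom in the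
head. -/
theorem IsAnswerSet.exists_rule (hS : IsAnswerSet Q S) {x : α} (hx : x ∈ S) :
    ∃ r ∈ Q, Disjoint r.neg S ∧ r.pos ⊆ S ∧ x ∈ r.head.reduct S :=
  hS.induction (P := fun x => ∃ r ∈ Q, Disjoint r.neg S ∧ r.pos ⊆ S ∧ x ∈ r.head.reduct S)
    (fun r hr hneg hpos _ _ hx => ⟨r, hr, hneg, hpos, hx⟩) hx

theorem eq_of_encard_inter_le_one {B : Set α} (hB : (B ∩ S).encard ≤ ((1 : ℕ) : ℕ∞)) {x y : α}
    (hx : x ∈ B) (hxS : x ∈ S) (hy : y ∈ B) (hyS : y ∈ S) : x = y := by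
  rw [Nat.cast_one, Set.encard_le_one_iff] at hB
  exact hB x y ⟨hx, hxS⟩ ⟨hy, hyS⟩

end AnswerSets

section Encoding

variable {F A : Type*} {D : Domain F A} {I G : Set (Lit F)} {h w : ℕ} {S : Set (Atom F A)}

/-- The literals that hold at row `t` of column `p`. -/
def stateAt (S : Set (Atom F A)) (t p : ℕ) : Set (Lit F) := {l | Atom.holds l t p ∈ S}

open Atom in
/-- The literals that are put into row `t` of column `p` by a rule other than a static causal
law. -/
def baseAt (S : Set (Atom F A)) (I : Set (Lit F)) : ℕ → ℕ → Set (Lit F)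
  | 0, _ => ∅
  | 1, p => {l | p = 1 ∧ l ∈ I}
  | t + 2, p => {l | e l (t + 1) p ∈ S ∨ (holds l (t + 1) p ∈ S ∧ pc l.compl (t + 1) p ∉ S) ∨
      (∃ p₁ ≤ p, br l (t + 1) p₁ p ∈ S) ∨
      ∃ g, ∃ p₁ < p, br g (t + 1) p₁ p ∈ S ∧ holds l (t + 1) p₁ ∈ S}

open Atom Set

/-! ### Occurrences, branches, used cells and goals -/

theorem contrary_mem_iff (hS : IsAnswerSet (encoding h w D I G) S) {l l₁ : Lit F} :
    contrary l l₁ ∈ S ↔ l₁ = l.compl := by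
  constructor
  · intro hx
    obtain ⟨r, hr, -, -, hx⟩ := hS.exists_rule hx
    -- The heads of all other rules are refuted here; what survives are the rules able to derive an
    -- atom of this kind.
    cases hr <;> simp [fact, normal, constraint, exactlyOne, Head.reduct] at hx
    case contrary_pos f => rw [hx.1, hx.2]; rfl
    case contrary_neg f => rw [hx.1, hx.2]; rfl
  · rintro rfl
    cases l with
    | pos f => exact hS.1 _ (.contrary_pos f) (by simp [fact]) (by simp [fact])
    | neg f => exact hS.1 _ (.contrary_neg f) (by simp [fact]) (by simp [fact])

theorem occ_mem (hS : IsAnswerSet (encoding h w D I G) S) {a : A} {t p : ℕ}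
    (hx : occ a t p ∈ S) :
    t ∈ Icc 1 h ∧ p ∈ Icc 1 w ∧ used t p ∈ S ∧ goal t p ∉ S := by
  obtain ⟨r, hr, hneg, hpos, hx⟩ := hS.exists_rule hx
  cases hr <;> simp [fact, normal, constraint, exactlyOne, Head.reduct] at hx
  case occ_generate t' p' ht hp =>
    obtain ⟨⟨rfl, rfl⟩, -⟩ := hx
    exact ⟨ht, hp, by simpa [exactlyOne] using hpos, by simpa [exactlyOne] using hneg⟩

theorem occ_unique (hS : IsAnswerSet (encoding h w D I G) S) {a b : A} {t p : ℕ}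
    (ha : occ a t p ∈ S) (hb : occ b t p ∈ S) : a = b := by
  obtain ⟨ht, hp, hu, hg⟩ := occ_mem hS ha
  have := (hS.1 _ (.occ_generate t p ht hp) (by simpa [exactlyOne] using hu)
    (by simpa [exactlyOne] using hg)).2
  simpa using eq_of_encard_inter_le_one this ⟨a, rfl⟩ ha ⟨b, rfl⟩ hb

theorem exists_occ (hS : IsAnswerSet (encoding h w D I G) S) {t p : ℕ} (ht : t ∈ Icc 1 h)
    (hp : p ∈ Icc 1 w) (hu : used t p ∈ S) (hg : goal t p ∉ S) : ∃ a, occ a t p ∈ S := by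
  have := (hS.1 _ (.occ_generate t p ht hp) (by simpa [exactlyOne] using hu)
    (by simpa [exactlyOne] using hg)).1
  obtain ⟨_, ⟨a, rfl⟩, ha⟩ := Set.one_le_encard_iff_nonempty.1 (by simpa using this)
  exact ⟨a, ha⟩

theorem br_mem (hS : IsAnswerSet (encoding h w D I G) S) {g : Lit F} {t p p₁ : ℕ}
    (hx : br g t p p₁ ∈ S) :
    p₁ ∈ Icc 1 w ∧ p ≤ p₁ ∧ ∃ a θ, Proposition.determines a θ ∈ D ∧ g ∈ θ ∧ occ a t p ∈ S := by
  obtain ⟨r, hr, hneg, hpos, hx⟩ := hS.exists_rule hx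
  cases hr <;> simp [fact, normal, constraint, exactlyOne, Head.reduct] at hx
  case sense_branch a θ g' t' p' ha hgθ ht hp =>
    obtain ⟨⟨hq, hle, rfl, rfl, rfl⟩, -⟩ := hx
    exact ⟨hq, hle, a, θ, ha, hgθ, by simpa [exactlyOne] using hpos⟩

theorem sensedLit_of_br_mem (hS : IsAnswerSet (encoding h w D I G) S) {g : Lit F} {t p p₁ : ℕ}
    (hx : br g t p p₁ ∈ S) : SensedLit D g := by
  obtain ⟨-, -, a, θ, ha, hg, -⟩ := br_mem hS hx
  exact ⟨a, θ, ha, hg⟩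

theorem exists_br (hS : IsAnswerSet (encoding h w D I G) S) {a : A} {θ : Set (Lit F)} {g : Lit F}
    {t p : ℕ} (hθ : Proposition.determines a θ ∈ D) (hg : g ∈ θ) (ha : occ a t p ∈ S) :
    ∃ p₁, br g t p p₁ ∈ S := by
  obtain ⟨ht, hp, -, -⟩ := occ_mem hS ha
  have := (hS.1 _ (.sense_branch a θ g t p hθ hg ht hp) (by simpa [exactlyOne] using ha)
    (by simp [exactlyOne])).1
  obtain ⟨_, ⟨q, -, -, rfl⟩, hq⟩ := Set.one_le_encard_iff_nonempty.1 (by simpa using this)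
  exact ⟨q, hq⟩

theorem br_target_unique (hS : IsAnswerSet (encoding h w D I G) S) {g : Lit F} {t p q q' : ℕ}
    (hq : br g t p q ∈ S) (hq' : br g t p q' ∈ S) : q = q' := by
  obtain ⟨hqw, hle, a, θ, hθ, hg, ha⟩ := br_mem hS hq
  obtain ⟨hqw', hle', -⟩ := br_mem hS hq'
  obtain ⟨ht, hp, -, -⟩ := occ_mem hS ha
  have := (hS.1 _ (.sense_branch a θ g t p hθ hg ht hp) (by simpa [exactlyOne] using ha)
    (by simp [exactlyOne])).2
  simpa using eq_of_encard_inter_le_one this ⟨q, hqw, hle, rfl⟩ hq ⟨q', hqw', hle', rfl⟩ hq'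

theorem br_label_unique (hS : IsAnswerSet (encoding h w D I G) S) {g g' : Lit F} {t p q : ℕ}
    (hg : br g t p q ∈ S) (hg' : br g' t p q ∈ S) : g = g' := by
  obtain ⟨hqw, hle, a, θ, -, -, ha⟩ := br_mem hS hg
  obtain ⟨ht, hp, -, -⟩ := occ_mem hS ha
  by_contra hne
  exact hS.1 _ (.br_label g g' t q p (sensedLit_of_br_mem hS hg) (sensedLit_of_br_mem hS hg')
    ht hqw hp hle hne) (by simp [constraint, Set.insert_subset_iff, hg, hg']) (by simp [constraint])

/-- The constraint compares only sources strictly to the left of the target. Branches that stay in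
their column are separated from these by `not_used_of_br_mem`. -/
theorem br_source_unique (hS : IsAnswerSet (encoding h w D I G) S) {g g' : Lit F} {t p p' q : ℕ}
    (hg : br g t p q ∈ S) (hg' : br g' t p' q ∈ S) (hp : p < q) (hp' : p' < q) : p = p' := by
  obtain ⟨hqw, -, a, θ, -, -, ha⟩ := br_mem hS hg
  obtain ⟨-, -, b, θ', -, -, hb⟩ := br_mem hS hg'
  obtain ⟨ht, hpw, -, -⟩ := occ_mem hS ha
  obtain ⟨-, hpw', -, -⟩ := occ_mem hS hb
  have hs := sensedLit_of_br_mem hS hg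
  have hs' := sensedLit_of_br_mem hS hg'
  rcases lt_trichotomy p p' with hlt | heq | hlt
  · exact (hS.1 _ (.br_source g g' t q p p' hs hs' ht hqw hpw hpw' hlt hp')
      (by simp [constraint, Set.insert_subset_iff, hg, hg']) (by simp [constraint])).elim
  · exact heq
  · exact (hS.1 _ (.br_source g' g t q p' p hs' hs ht hqw hpw' hpw hlt hp)
      (by simp [constraint, Set.insert_subset_iff, hg, hg']) (by simp [constraint])).elim

theorem not_used_of_br_mem (hS : IsAnswerSet (encoding h w D I G) S) {g : Lit F} {t p q : ℕ}
    (hg : br g t p q ∈ S) (hpq : p < q) : used t q ∉ S := by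
  intro hu
  obtain ⟨hqw, -, a, θ, -, -, ha⟩ := br_mem hS hg
  obtain ⟨ht, hp, -, -⟩ := occ_mem hS ha
  exact hS.1 _ (.br_fresh g t q p (sensedLit_of_br_mem hS hg) ht hqw hp hpq)
    (by simp [constraint, Set.insert_subset_iff, hg, hu]) (by simp [constraint])

theorem used_succ_of_used (hS : IsAnswerSet (encoding h w D I G) S) {t p : ℕ} (ht : t ∈ Icc 1 h)
    (hp : p ∈ Icc 1 w) (hu : used t p ∈ S) : used (t + 1) p ∈ S :=
  hS.1 _ (.used_next t p ht hp) (by simpa [normal] using hu) (by simp [normal])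

theorem used_succ_of_br_mem (hS : IsAnswerSet (encoding h w D I G) S) {g : Lit F} {t p q : ℕ}
    (hg : br g t p q ∈ S) : used (t + 1) q ∈ S := by
  obtain ⟨hqw, hle, a, θ, -, -, ha⟩ := br_mem hS hg
  obtain ⟨ht, hp, hu, -⟩ := occ_mem hS ha
  rcases hle.eq_or_lt with rfl | hlt
  · exact used_succ_of_used hS ht hp hu
  · exact hS.1 _ (.br_used g t q p (sensedLit_of_br_mem hS hg) ht hqw hp hlt)
      (by simpa [normal] using hg) (by simp [normal])

theorem executable_of_occ_mem (hS : IsAnswerSet (encoding h w D I G) S) {a : A} {t p : ℕ}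
    (ha : occ a t p ∈ S) : Executable D a (stateAt S t p) := by
  obtain ⟨ht, hp, -, -⟩ := occ_mem hS ha
  have hposs : poss a t p ∈ S := by
    by_contra hn
    exact hS.1 _ (.occ_poss a t p ht hp) (by simpa [constraint] using ha)
      (by simpa [constraint] using hn)
  obtain ⟨r, hr, hneg, hpos, hx⟩ := hS.exists_rule hposs
  cases hr <;> simp [fact, normal, constraint, exactlyOne, Head.reduct] at hx
  case poss b ψ t' p' hψ _ _ =>
    obtain ⟨rfl, rfl, rfl⟩ := hx
    exact ⟨ψ, hψ, fun l hl => hpos ⟨l, hl, rfl⟩⟩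

/-- Inconsistent cells count as goals too; consistency excludes that derivation. -/
theorem subset_stateAt_of_goal_mem (hS : IsAnswerSet (encoding h w D I G) S) {t p : ℕ}
    (hg : goal t p ∈ S) (hc : Consistent (stateAt S t p)) : G ⊆ stateAt S t p := by
  obtain ⟨r, hr, hneg, hpos, hx⟩ := hS.exists_rule hg
  cases hr <;> simp [fact, normal, constraint, exactlyOne, Head.reduct] at hx
  case goal_reached t' p' _ _ =>
    obtain ⟨rfl, rfl⟩ := hx
    exact fun l hl => hpos ⟨l, hl, rfl⟩
  case goal_inconsistent l l₁ t' p' _ _ =>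
    obtain ⟨rfl, rfl⟩ := hx
    simp only [normal, Set.insert_subset_iff, Set.singleton_subset_iff] at hpos
    obtain ⟨hl, hl₁, hco⟩ := hpos
    rw [contrary_mem_iff hS] at hco
    subst hco
    exact (hc l hl hl₁).elim

theorem goal_final_mem (hS : IsAnswerSet (encoding h w D I G) S) {p : ℕ} (hp : p ∈ Icc 1 w)
    (hu : used (h + 1) p ∈ S) : goal (h + 1) p ∈ S := by
  by_contra hn
  exact hS.1 _ (.goal_check p hp) (by simpa [constraint] using hu) (by simpa [constraint] using hn)

/-! ### Effects and possible changes -/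

/-- Static laws have non-empty bodies, so a derivation of an `e` atom can be traced back to a
dynamic law, whose action is non-sensing. -/
theorem exists_occ_of_e_mem (hD : WellFormed D) (hS : IsAnswerSet (encoding h w D I G) S)
    {l : Lit F} {t p : ℕ} (hl : e l t p ∈ S) : ∃ a, occ a t p ∈ S ∧ ¬ Sensing D a := by
  refine hS.induction (P := fun x => ∀ l, x = e l t p → ∃ a, occ a t p ∈ S ∧ ¬ Sensing D a)
    ?_ hl l rfl
  rintro r hr hneg hpos ih x hx l rfl
  cases hr <;> simp [fact, normal, constraint, exactlyOne, Head.reduct] at hx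
  case causes_e a m φ t' p' hφ _ _ =>
    obtain ⟨rfl, rfl, rfl⟩ := hx
    exact ⟨a, hpos (Or.inl rfl), hD.disjoint _ _ _ hφ⟩
  case static_e m φ t' p' hφ _ _ =>
    obtain ⟨rfl, rfl, rfl⟩ := hx
    obtain ⟨m, hm⟩ := hD.static_nonempty _ _ hφ
    exact ih _ ⟨m, hm, rfl⟩ m rfl

/-- Both sides are the least set that contains the direct effects and satisfies the static laws; no
other action in the cell can contribute. -/
theorem e_mem_iff (hS : IsAnswerSet (encoding h w D I G) S) {a : A} {l : Lit F} {t p : ℕ}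
    (ha : occ a t p ∈ S) : e l t p ∈ S ↔ l ∈ eff D a (stateAt S t p) := by
  obtain ⟨ht, hp, -, -⟩ := occ_mem hS ha
  constructor
  · intro hl
    refine hS.induction (P := fun x => ∀ l, x = e l t p → l ∈ eff D a (stateAt S t p))
      ?_ hl l rfl
    rintro r hr hneg hpos ih x hx l rfl
    cases hr <;> simp [fact, normal, constraint, exactlyOne, Head.reduct] at hx
    case causes_e b m φ t' p' hφ _ _ =>
      obtain ⟨rfl, rfl, rfl⟩ := hx
      obtain rfl := occ_unique hS ha (hpos (Or.inl rfl))
      exact subset_Cl ⟨φ, hφ, fun m hm => hpos (Or.inr ⟨m, hm, rfl⟩)⟩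
    case static_e m φ t' p' hφ _ _ =>
      obtain ⟨rfl, rfl, rfl⟩ := hx
      exact satisfiesStatic_Cl _ φ hφ fun m hm => ih _ ⟨m, hm, rfl⟩ m rfl
  · intro hl
    refine Cl_subset (τ := {l | e l t p ∈ S}) ?_ ?_ hl
    · rintro m ⟨φ, hφ, hsub⟩
      refine hS.1 _ (.causes_e a m φ t p hφ ht hp) ?_ (by simp [normal])
      rintro _ (rfl | ⟨m', hm', rfl⟩)
      · exact ha
      · exact hsub hm'
    · intro m φ hφ hsub
      refine hS.1 _ (.static_e m φ t p hφ ht hp) ?_ (by simp [normal])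
      rintro _ ⟨m', hm', rfl⟩
      exact hsub hm'

theorem exists_occ_of_pc_mem (hD : WellFormed D) (hS : IsAnswerSet (encoding h w D I G) S)
    {l : Lit F} {t p : ℕ} (hl : pc l t p ∈ S) : ∃ a, occ a t p ∈ S ∧ ¬ Sensing D a := by
  refine hS.induction (P := fun x => ∀ l, x = pc l t p → ∃ a, occ a t p ∈ S ∧ ¬ Sensing D a)
    ?_ hl l rfl
  rintro r hr hneg hpos ih x hx l rfl
  cases hr <;> simp [fact, normal, constraint, exactlyOne, Head.reduct] at hx
  case causes_pc a m φ t' p' hφ _ _ =>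
    obtain ⟨rfl, rfl, rfl⟩ := hx
    exact ⟨a, hpos rfl, hD.disjoint _ _ _ hφ⟩
  case static_pc m φ m' t' p' hφ _ _ _ =>
    obtain ⟨rfl, rfl, rfl⟩ := hx
    exact ih _ rfl m' rfl

theorem possiblyHolds_iff {γ σ : Set (Lit F)} :
    PossiblyHolds γ σ ↔ ∀ m ∈ γ, m.compl ∉ σ := by
  simp [PossiblyHolds, Set.eq_empty_iff_forall_notMem]

/-- Stages of `pcStage` match steps of a derivation. The negated `e` atoms in the bodies have the
right meaning because `e_mem_iff` is already exact. -/
theorem pc_mem_iff (hS : IsAnswerSet (encoding h w D I G) S) {a : A} {l : Lit F} {t p : ℕ}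
    (ha : occ a t p ∈ S) : pc l t p ∈ S ↔ l ∈ possibleChanges D a (stateAt S t p) := by
  obtain ⟨ht, hp, -, -⟩ := occ_mem hS ha
  constructor
  · intro hl
    refine hS.induction (P := fun x => ∀ l, x = pc l t p →
      l ∈ possibleChanges D a (stateAt S t p)) ?_ hl l rfl
    rintro r hr hneg hpos ih x hx l rfl
    cases hr <;> simp [fact, normal, constraint, exactlyOne, Head.reduct] at hx
    case causes_pc b m φ t' p' hφ _ _ =>
      obtain ⟨rfl, rfl, rfl⟩ := hx
      obtain rfl := occ_unique hS ha (hpos rfl)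
      refine Set.mem_iUnion.2 ⟨0, φ, hφ, Set.disjoint_left.1 hneg (Or.inl rfl),
        possiblyHolds_iff.2 fun m hm => Set.disjoint_left.1 hneg (Or.inr ⟨m, hm, rfl⟩)⟩
    case static_pc m φ m' t' p' hφ hm' _ _ =>
      obtain ⟨rfl, rfl, rfl⟩ := hx
      obtain ⟨i, hi⟩ := Set.mem_iUnion.1 (ih _ rfl m' rfl)
      refine Set.mem_iUnion.2 ⟨i + 1, Or.inr ⟨φ, hφ, Set.disjoint_left.1 hneg (Or.inl rfl),
        ⟨m', hm', hi⟩, possiblyHolds_iff.2 fun m hm hme => ?_⟩⟩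
      exact Set.disjoint_left.1 hneg (Or.inr ⟨m, hm, rfl⟩) ((e_mem_iff hS ha).2 hme)
  · intro hl
    obtain ⟨i, hi⟩ := Set.mem_iUnion.1 hl
    clear hl
    induction i generalizing l with
    | zero =>
      obtain ⟨φ, hφ, hlδ, hposs⟩ := hi
      refine hS.1 _ (.causes_pc a l φ t p hφ ht hp) (by simpa [normal] using ha) ?_
      refine Set.disjoint_left.2 ?_
      rintro _ (rfl | ⟨m, hm, rfl⟩)
      · exact hlδ
      · exact possiblyHolds_iff.1 hposs m hm
    | succ i ih =>
      rcases hi with hi | ⟨φ, hφ, hlδ, ⟨m', hm', hi⟩, hposs⟩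
      · exact ih hi
      · refine hS.1 _ (.static_pc l φ m' t p hφ hm' ht hp) (by simpa [normal] using ih hi) ?_
        refine Set.disjoint_left.2 ?_
        rintro _ (rfl | ⟨m, hm, rfl⟩)
        · exact hlδ
        · exact fun hme => possiblyHolds_iff.1 hposs m hm ((e_mem_iff hS ha).1 hme)

/-! ### Evolution of the literal sets -/

theorem stateAt_subset (hS : IsAnswerSet (encoding h w D I G) S) (t p : ℕ) :
    stateAt S t p ⊆ Cl D (baseAt S I t p) := by
  intro l hl
  refine hS.induction (P := fun x => ∀ l, x = holds l t p → l ∈ Cl D (baseAt S I t p)) ?_ hl l rfl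
  rintro r hr hneg hpos ih x hx l rfl
  -- Times start at 1, so the row after a time has the form `k + 2`, the last case of `baseAt`.
  have succ_pred {n : ℕ} (hn : n ∈ Icc 1 h) : ∃ k, n = k + 1 := ⟨n - 1, by have := hn.1; omega⟩
  cases hr <;> simp [fact, normal, constraint, exactlyOne, Head.reduct] at hx
  case init m hm =>
    obtain ⟨rfl, rfl, rfl⟩ := hx
    exact subset_Cl ⟨rfl, hm⟩
  case static_holds m φ t' p' hφ _ _ =>
    obtain ⟨rfl, rfl, rfl⟩ := hx
    exact satisfiesStatic_Cl _ φ hφ fun m hm => ih _ ⟨m, hm, rfl⟩ m rfl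
  case effect m t' p' ht _ =>
    obtain ⟨rfl, rfl, rfl⟩ := hx
    obtain ⟨k, rfl⟩ := succ_pred ht
    exact subset_Cl (Or.inl (hpos rfl))
  case inertia m m₁ t' p' ht _ =>
    obtain ⟨rfl, rfl, rfl⟩ := hx
    obtain ⟨k, rfl⟩ := succ_pred ht
    obtain rfl := (contrary_mem_iff hS).1 (hpos (Or.inr rfl))
    exact subset_Cl (Or.inr (Or.inl ⟨hpos (Or.inl rfl), Set.disjoint_left.1 hneg rfl⟩))
  case br_holds g t' p' p₁ _ ht _ _ hle =>
    obtain ⟨rfl, rfl, rfl⟩ := hx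
    obtain ⟨k, rfl⟩ := succ_pred ht
    exact subset_Cl (Or.inr (Or.inr (Or.inl ⟨p₁, hle, hpos rfl⟩)))
  case br_copy g m t' p' p₁ _ ht _ _ hlt =>
    obtain ⟨rfl, rfl, rfl⟩ := hx
    obtain ⟨k, rfl⟩ := succ_pred ht
    exact subset_Cl (Or.inr (Or.inr (Or.inr
      ⟨g, p₁, hlt, hpos (Or.inl rfl), hpos (Or.inr rfl)⟩)))

theorem satisfiesStatic_stateAt (hS : IsAnswerSet (encoding h w D I G) S) {t p : ℕ}
    (ht : t ∈ Icc 1 (h + 1)) (hp : p ∈ Icc 1 w) : SatisfiesStatic D (stateAt S t p) := by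
  intro l φ hφ hsub
  refine hS.1 _ (.static_holds l φ t p hφ ht hp) ?_ (by simp [normal])
  rintro _ ⟨m, hm, rfl⟩
  exact hsub hm

theorem stateAt_one_one (hS : IsAnswerSet (encoding h w D I G) S) (hw : 1 ≤ w) :
    stateAt S 1 1 = initialAState D I := by
  refine Set.Subset.antisymm ?_ ?_
  · simpa [baseAt, initialAState] using stateAt_subset hS 1 1
  · exact Cl_subset (fun l hl => hS.1 _ (.init l hl) (by simp [fact]) (by simp [fact]))
      (satisfiesStatic_stateAt hS (by simp) (by simpa using hw))

theorem stateAt_succ (hS : IsAnswerSet (encoding h w D I G) S) {t p : ℕ}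
    (ht : t + 1 ∈ Icc 1 h) (hp : p ∈ Icc 1 w) :
    stateAt S (t + 2) p = Cl D (baseAt S I (t + 2) p) := by
  refine Set.Subset.antisymm (stateAt_subset hS _ p) (Cl_subset ?_ (satisfiesStatic_stateAt hS
    ⟨by omega, by have := ht.2; omega⟩ hp))
  rintro l (hl | ⟨hl, hl'⟩ | ⟨p₁, hle, hl⟩ | ⟨g, p₁, hlt, hg, hl⟩)
  · exact hS.1 _ (.effect l (t + 1) p ht hp) (by simpa [normal] using hl) (by simp [normal])
  · refine hS.1 _ (.inertia l l.compl (t + 1) p ht hp) ?_ (by simpa [normal] using hl')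
    simp only [normal, Set.insert_subset_iff, Set.singleton_subset_iff]
    exact ⟨hl, (contrary_mem_iff hS).2 rfl⟩
  · obtain ⟨-, -, a, -, -, -, ha⟩ := br_mem hS hl
    exact hS.1 _ (.br_holds l (t + 1) p p₁ (sensedLit_of_br_mem hS hl) ht hp (occ_mem hS ha).2.1 hle)
      (by simpa [normal] using hl) (by simp [normal])
  · obtain ⟨-, -, a, -, -, -, ha⟩ := br_mem hS hg
    exact hS.1 _ (.br_copy g l (t + 1) p p₁ (sensedLit_of_br_mem hS hg) ht hp (occ_mem hS ha).2.1
      hlt) (by simp [normal, Set.insert_subset_iff, hg, hl]) (by simp [normal])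

/-- Nothing holds in an unused part of a column. -/
theorem stateAt_eq_empty (hD : WellFormed D) (hS : IsAnswerSet (encoding h w D I G) S) {t p : ℕ}
    (ht : t ≤ h) (hp : p ∈ Icc 1 w) (hu : used t p ∉ S) : stateAt S t p = ∅ := by
  suffices hb : baseAt S I t p ⊆ ∅ by
    have := stateAt_subset hS t p
    rwa [Set.subset_empty_iff.1 hb, Cl_empty hD, Set.subset_empty_iff] at this
  induction t using Nat.strong_induction_on with
  | _ t ih =>
    match t, ih with
    | 0, _ => exact subset_rfl
    | 1, _ =>
      rintro l ⟨rfl, -⟩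
      exact hu (hS.1 _ .used_root (by simp [fact]) (by simp [fact]))
    | t + 2, ih =>
      -- Use persists downwards in a column, so the row above is unused as well. It is empty by
      -- induction, and an effect or an incoming branch would make this row used.
      have hu' : used (t + 1) p ∉ S := fun hn =>
        hu (used_succ_of_used hS ⟨by omega, by omega⟩ hp hn)
      have hb := ih (t + 1) (by omega) (by omega) hu'
      have hδ := stateAt_subset hS (t + 1) p
      rw [Set.subset_empty_iff.1 hb, Cl_empty hD] at hδ
      rintro l (hl | ⟨hl, -⟩ | ⟨p₁, hle, hl⟩ | ⟨g, p₁, hlt, hg, -⟩)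
      · obtain ⟨a, ha, -⟩ := exists_occ_of_e_mem hD hS hl
        exact hu' (occ_mem hS ha).2.2.1
      · exact hδ hl
      · exact hu (used_succ_of_br_mem hS hl)
      · exact hu (used_succ_of_br_mem hS hg)

/-- Only effects and inertia contribute: a branch from the column to itself needs a sensing action,
and a branch from another column needs an unused target. -/
theorem stateAt_succ_of_nonSensing (hS : IsAnswerSet (encoding h w D I G) S)
    {a : A} {t p : ℕ} (ha : occ a t p ∈ S) (hns : ¬ Sensing D a) :
    stateAt S (t + 1) p = Cl D (eff D a (stateAt S t p) ∪
      (stateAt S t p \ (Lit.compl '' possibleChanges D a (stateAt S t p)))) := by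
  obtain ⟨ht, hp, hu, -⟩ := occ_mem hS ha
  obtain ⟨t, rfl⟩ : ∃ k, t = k + 1 := ⟨t - 1, by have := ht.1; omega⟩
  rw [stateAt_succ hS ht hp]
  congr 1
  ext l
  simp only [Set.mem_union, Set.mem_sdiff, Lit.mem_image_compl, ← e_mem_iff hS ha,
    ← pc_mem_iff hS ha]
  constructor
  · rintro (hl | hl | ⟨p₁, hle, hl⟩ | ⟨g, p₁, hlt, hg, -⟩)
    · exact Or.inl hl
    · exact Or.inr hl
    · rcases hle.eq_or_lt with rfl | hlt
      · obtain ⟨-, -, b, θ, hθ, -, hb⟩ := br_mem hS hl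
        obtain rfl := occ_unique hS ha hb
        exact (hns ⟨θ, hθ⟩).elim
      · exact (not_used_of_br_mem hS hl hlt hu).elim
    · exact (not_used_of_br_mem hS hg hlt hu).elim
  · rintro (hl | hl)
    · exact Or.inl hl
    · exact Or.inr (Or.inl hl)

/-- If the branch stays in its column, inertia preserves everything, as sensing causes no changes.
If it moves to the right, the target was empty and receives a copy of its only source. -/
theorem stateAt_succ_of_br_mem (hD : WellFormed D) (hS : IsAnswerSet (encoding h w D I G) S)
    {g : Lit F} {t p q : ℕ} (hg : br g t p q ∈ S) :
    stateAt S (t + 1) q = Cl D (stateAt S t p ∪ {g}) := by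
  obtain ⟨hq, hpq, a, θ, hθ, hgθ, ha⟩ := br_mem hS hg
  obtain ⟨ht, hp, hu, -⟩ := occ_mem hS ha
  obtain ⟨t, rfl⟩ : ∃ k, t = k + 1 := ⟨t - 1, by have := ht.1; omega⟩
  rw [stateAt_succ hS ht hq]
  -- Hence there are no `e` or `pc` atoms in row `t + 1` of column `q`.
  have hns {b : A} (hb : occ b (t + 1) q ∈ S) : Sensing D b := by
    rcases hpq.eq_or_lt with rfl | hlt
    · obtain rfl := occ_unique hS ha hb
      exact ⟨θ, hθ⟩
    · exact (not_used_of_br_mem hS hg hlt (occ_mem hS hb).2.2.1).elim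
  congr 1
  ext l
  constructor
  · rintro (hl | ⟨hl, -⟩ | ⟨p₁, hle, hl⟩ | ⟨g', p₁, hlt', hg', hl⟩)
    · obtain ⟨b, hb, hb'⟩ := exists_occ_of_e_mem hD hS hl
      exact (hb' (hns hb)).elim
    · rcases hpq.eq_or_lt with rfl | hlt
      · exact Or.inl hl
      · have hl' : l ∈ stateAt S (t + 1) q := hl
        rw [stateAt_eq_empty hD hS ht.2 hq (not_used_of_br_mem hS hg hlt)] at hl'
        exact hl'.elim
    -- A branch staying in column `q` makes `q` used, which forbids a second branch from the left;
    -- two branches from the left share their source.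
    · have hp₁ : p = p₁ := by
        obtain ⟨-, -, b, -, -, -, hb⟩ := br_mem hS hl
        have hub := (occ_mem hS hb).2.2.1
        rcases hpq.eq_or_lt with rfl | hlt <;> rcases hle.eq_or_lt with rfl | hlt'
        · rfl
        · exact (not_used_of_br_mem hS hl hlt' hu).elim
        · exact (not_used_of_br_mem hS hg hlt hub).elim
        · exact br_source_unique hS hg hl hlt hlt'
      subst hp₁
      exact Or.inr (br_label_unique hS hl hg)
    · rcases hpq.eq_or_lt with rfl | hlt
      · exact (not_used_of_br_mem hS hg' hlt' hu).elim
      · obtain rfl := br_source_unique hS hg hg' hlt hlt'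
        exact Or.inl hl
  · rintro (hl | rfl)
    · rcases hpq.eq_or_lt with rfl | hlt
      · refine Or.inr (Or.inl ⟨hl, fun hpc => ?_⟩)
        obtain ⟨b, hb, hb'⟩ := exists_occ_of_pc_mem hD hS hpc
        exact hb' (hns hb)
      · exact Or.inr (Or.inr (Or.inr ⟨g, p, hlt, hg, hl⟩))
    · exact Or.inr (Or.inr (Or.inl ⟨p, hpq, hg⟩))

/-! ### Extraction and evaluation of the plan -/

theorem existsUnique_extractedPlan (hD : WellFormed D)
    (hS : IsAnswerSet (encoding h w D I G) S) {i k : ℕ} (hi : i ≤ h + 1) :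
    ∃ p, ExtractedPlan D h S i k p ∧ (∀ q, ExtractedPlan D h S i k q → q = p) ∧
      IsConditionalPlan D p := by
  -- Downward from row `h + 1`, for all columns at once, since the cases of a sensing action
  -- continue in different columns.
  induction hi using Nat.decreasingInduction generalizing k with
  | self =>
    refine ⟨.empty, .finished _ _ (Or.inl rfl), fun q hq => ?_, trivial⟩
    match q, hq with
    | _, .finished _ _ _ => rfl
    | _, .nonSensing _ _ a p hle _ _ _ => omega
    | _, .sensing _ _ a θ c p hle _ _ _ _ => omega
  | of_succ i hi ih =>
    by_cases hocc : ∃ a, occ a i k ∈ S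
    · obtain ⟨a, ha⟩ := hocc
      have hih : i ≤ h := (occ_mem hS ha).1.2
      by_cases hs : Sensing D a
      · obtain ⟨θ, hθ⟩ := hs
        choose c hc using fun g : θ => exists_br hS hθ g.2 ha
        choose p hp hp' hp'' using fun g : θ => ih (k := c g)
        refine ⟨.cases a θ p, .sensing i k a θ c p hih ha hθ hc hp, fun q hq => ?_, hθ, hp''⟩
        match q, hq with
        | _, .finished _ _ hf =>
          rcases hf with hf | hf
          · omega
          · exact (hf a ha).elim
        | _, .nonSensing _ _ b q _ hb hns _ =>
          obtain rfl := occ_unique hS ha hb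
          exact (hns ⟨θ, hθ⟩).elim
        | _, .sensing _ _ b θ' c' q _ hb hθ' hc' hq =>
          obtain rfl := occ_unique hS ha hb
          obtain rfl := hD.determines_unique a θ θ' hθ hθ'
          obtain rfl : c = c' := funext fun g => br_target_unique hS (hc g) (hc' g)
          congr 1
          exact funext fun g => hp' g _ (hq g)
      · obtain ⟨p, hp, hp', hp''⟩ := ih (k := k)
        refine ⟨.seq a p, .nonSensing i k a p hih ha hs hp, fun q hq => ?_, hs, hp''⟩
        match q, hq with
        | _, .finished _ _ hf =>
          rcases hf with hf | hf
          · omega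
          · exact (hf a ha).elim
        | _, .nonSensing _ _ b q _ hb _ hq =>
          obtain rfl := occ_unique hS ha hb
          rw [hp' _ hq]
        | _, .sensing _ _ b θ' c' q _ hb hθ' _ _ =>
          obtain rfl := occ_unique hS ha hb
          exact (hs ⟨θ', hθ'⟩).elim
    · rw [not_exists] at hocc
      refine ⟨.empty, .finished _ _ (Or.inr hocc), fun q hq => ?_, trivial⟩
      match q, hq with
      | _, .finished _ _ _ => rfl
      | _, .nonSensing _ _ a p _ ha _ _ => exact (hocc a ha).elim
      | _, .sensing _ _ a θ c p _ ha _ _ _ => exact (hocc a ha).elim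

theorem unionBot_spec {ι β : Type*} {s : Set ι} {f : ι → Option (Set β)} {P : β → Prop}
    (hf : ∀ i ∈ s, ∃ X, f i = some X ∧ ∀ x ∈ X, P x) :
    ∃ X, unionBot s f = some X ∧ ∀ x ∈ X, P x := by
  have hn : ¬ ∃ i ∈ s, f i = none := by
    rintro ⟨i, hi, hn⟩
    obtain ⟨X, hX, -⟩ := hf i hi
    simp [hn] at hX
  refine ⟨_, if_neg hn, ?_⟩
  rintro x ⟨i, hi, Y, hY, hx⟩
  obtain ⟨X, hX, hP⟩ := hf i hi
  obtain rfl : X = Y := by simpa [hX] using hY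
  exact hP x hx

/-- An extracted plan achieves the goal from the literals that hold where the extraction starts. -/
theorem ExtractedPlan.phiHat (hD : WellFormed D) (hS : IsAnswerSet (encoding h w D I G) S)
    {i k : ℕ} {p : Plan F A} (hp : ExtractedPlan D h S i k p) (hi : i ∈ Icc 1 (h + 1))
    (hk : k ∈ Icc 1 w) (hu : used i k ∈ S) (hc : Consistent (stateAt S i k)) :
    ∃ X, PhiHat D p (stateAt S i k) = some X ∧ ∀ δ ∈ X, G ⊆ δ := by
  induction hp with
  | finished i k hf =>
    refine ⟨_, rfl, ?_⟩
    rintro _ rfl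
    refine subset_stateAt_of_goal_mem hS ?_ hc
    -- In the last row `goal_check` forces the goal; in earlier rows a used cell without the goal
    -- would have an occurrence, and the extraction would go on.
    by_contra hg
    have hih : i ≠ h + 1 := by
      rintro rfl
      exact hg (goal_final_mem hS hk hu)
    obtain ⟨a, ha⟩ := exists_occ hS ⟨hi.1, by have := hi.2; omega⟩ hk hu hg
    exact hf.elim hih fun hf => hf a ha
  | nonSensing i k a p hih ha hns _ ih =>
    have hPhi : Phi D a (stateAt S i k) = some (ResNonSensing D a (stateAt S i k)) := by
      simp [Phi, executable_of_occ_mem hS ha, hns]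
    simp only [PhiHat, hPhi]
    apply unionBot_spec
    -- Membership in the result includes consistency, which is what the induction hypothesis
    -- requires of the next cell.
    rintro _ ⟨rfl, hcons⟩
    rw [← stateAt_succ_of_nonSensing hS ha hns] at hcons ⊢
    exact ih ⟨by omega, by omega⟩ hk (used_succ_of_used hS ⟨hi.1, hih⟩ hk hu) hcons
  | sensing i k a θ c p hih ha hθ hc' _ ih =>
    have hPhi : Phi D a (stateAt S i k) = some (ResSensing D a (stateAt S i k)) := by
      simp [Phi, executable_of_occ_mem hS ha, show Sensing D a from ⟨θ, hθ⟩]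
    simp only [PhiHat, hPhi]
    apply unionBot_spec
    rintro ⟨g, _⟩ ⟨⟨θ', hθ', g', hg', rfl, hcons⟩, hgδ⟩
    obtain rfl := hD.determines_unique a θ θ' hθ hθ'
    -- The result obtained by sensing `g'` is matched with a case `g` that holds in it. As sensed
    -- literals exclude each other, it enters only its own case, the one that its column encodes.
    obtain rfl : (g : Lit F) = g' := hD.eq_of_mem_of_mem hθ satisfiesStatic_Cl hcons g.2 hg' hgδ
      (subset_Cl (Or.inr rfl))
    rw [← stateAt_succ_of_br_mem hD hS (hc' g)] at hcons
    simp only [← stateAt_succ_of_br_mem hD hS (hc' g)]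
    exact ih g ⟨by omega, by omega⟩ (br_mem hS (hc' g)).1 (used_succ_of_br_mem hS (hc' g)) hcons

end Encoding

end ASCP

/-- Soundness of the encoding: the extraction procedure, applied to an answer set, returns exactly
one plan, and this plan is a solution. -/
theorem theorem3p1 {F A : Type*} (D : ASCP.Domain F A) (I G : Set (ASCP.Lit F))
    (hD : ASCP.WellFormed D) (hG : G.Nonempty) (hcons : ASCP.ConsistentTheory D I)
    (h w : ℕ) (hh : 1 ≤ h) (hw : 1 ≤ w) (S : Set (ASCP.Atom F A))
    (hS : ASCP.IsAnswerSet (ASCP.encoding h w D I G) S) :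
    ∃ p : ASCP.Plan F A, ASCP.ExtractedPlan D h S 1 1 p ∧
      (∀ q, ASCP.ExtractedPlan D h S 1 1 q → q = p) ∧
      ASCP.IsSolution D I G p := by
  obtain ⟨p, hp, hunique, hcond⟩ :=
    ASCP.existsUnique_extractedPlan hD hS (i := 1) (k := 1) (by omega)
  have hstate := ASCP.stateAt_one_one hS hw
  refine ⟨p, hp, hunique, hcond, ?_⟩
  rw [ASCP.EntailsKnowsAfter, ← hstate]
  exact hp.phiHat hD hS (by simp) (by simpa using hw)
    (hS.1 _ .used_root (by simp [ASCP.fact]) (by simp [ASCP.fact]))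
    -- Consistency of the initial a-state starts the induction.
    (hstate ▸ hcons.2.1.1)
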